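/- Bennett's pebble game is played on a board of $n\ge 1$ squares $s_1,\dots,s_n$, each empty or holding one pebble. A move adds a pebble to an empty square $s_i$ or removes the pebble from an occupied square $s_i$; it is allowed if $i=1$ or if there is a pebble on $s_{i-1}$. The board is initially empty, and a solution is a finite sequence of moves after which there is exactly one pebble on the board, on $s_n$. Let $F(n,S)$ be the minimum number of moves of a solution in which there are never more than $S$ pebbles on the board, with $F(n,S)=\infty$ if there is no such solution. Let $\log$ be the logarithm to base 2 (with $\log\infty=\infty$), let $$f(\gamma,S)=\frac1S\log F\left(\lfloor 2^{\gamma S}\rfloor,S\right)\in[0,\infty]$$ for $\gamma\ge 0$ and integers $S\ge 1$, and for $0\le\gamma\le 1$ let $H(\gamma)=-\gamma\log\gamma-(1-\gamma)\log(1-\gamma)$, where $0\log 0=0$. **Theorem 2.11.** (i) For every fixed $\gamma$ with $0\le\gamma<1/2$, $$f(H(\gamma),S)\le \gamma+H(\gamma)+o(1)\qquad (S\to\infty).$$ (ii) For every fixed $\gamma$ with $0\le\gamma\le 1/2$, $$f\left((1+\gamma)H\left(\tfrac{\gamma}{1+\gamma}\right),S\right)\ge \gamma+(1+\gamma)H\left(\tfrac{\gamma}{1+\gamma}\right)+o(1)\qquad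 (S\to\infty).$$ The $o(1)$ terms may depend on $\gamma$, and the inequalities are asserted for all sufficiently large $S$. (iii) As $\gamma\to 0^+$, $H(\gamma)=(1+\gamma)H\left(\frac{\gamma}{1+\gamma}\right)+O(\gamma^2)$; hence also the two right-hand sides $\gamma+H(\gamma)$ and $\gamma+(1+\gamma)H\left(\frac{\gamma}{1+\gamma}\right)$ differ by $O(\gamma^2)$. -/

import Mathlib

open Filter Topology Asymptotics
open scoped ENNReal

namespace PebbleGame

/-- A legal move on the board with squares `1, …, n`. A configuration is the finite set of the
squares holding a pebble. One pebble is added to or removed from a square `i`, which is allowed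
if `i = 1` or if there is a pebble on square `i - 1`. -/
def Move (n : ℕ) (c c' : Finset ℕ) : Prop :=
  ∃ i : ℕ, 1 ≤ i ∧ i ≤ n ∧ (i = 1 ∨ i - 1 ∈ c) ∧
    ((i ∉ c ∧ c' = insert i c) ∨ (i ∈ c ∧ c' = c.erase i))

/-- A solution of the pebble game on `n` squares: `config t` is the configuration after the
`t`-th move, for `t = 0, …, time`; the values of `config` at later times play no role. The board
is empty at the start, and at the end there is exactly one pebble, on square `n`. -/
structure Solution (n : ℕ) where
  /-- the number of moves -/
  time : ℕ
  /-- the configuration after each move -/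
  config : ℕ → Finset ℕ
  start : config 0 = ∅
  finish : config time = {n}
  step : ∀ t < time, Move n (config t) (config (t + 1))

/-- The maximum number of pebbles on the board at any time. -/
def Solution.space {n : ℕ} (s : Solution n) : ℕ :=
  (Finset.range (s.time + 1)).sup fun t => (s.config t).card

/-- `F n S` is the least number of moves of a solution on `n` squares that uses at most `S`
pebbles; it is `⊤` (infinite) if there is no such solution. -/
noncomputable def F (n S : ℕ) : ℕ∞ :=
  ⨅ (s : Solution n) (_ : s.space ≤ S), (s.time : ℕ∞)

/-- The binary logarithm on `[0, ∞]`, with values in `[-∞, ∞]`. -/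
noncomputable def log2 (x : ℝ≥0∞) : EReal :=
  ENNReal.log x / ((Real.log 2 : ℝ) : EReal)

/-- `f γ S = (1 / S) * log₂ F(⌊2 ^ (γ S)⌋, S)`, which is `⊤` if `F(⌊2 ^ (γ S)⌋, S)` is
infinite and `0 < S`. -/
noncomputable def f (γ : ℝ) (S : ℕ) : EReal :=
  ((1 / (S : ℝ) : ℝ) : EReal) * log2 ((F ⌊(2 : ℝ) ^ (γ * (S : ℝ))⌋₊ S : ℕ∞) : ℝ≥0∞)

/-- The binary entropy function, in bits (with `0 * log 0 = 0`). -/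
noncomputable def H (γ : ℝ) : ℝ :=
  -γ * Real.logb 2 γ - (1 - γ) * Real.logb 2 (1 - γ)

end PebbleGame

/-!
Upper bound: to reach square `m + w`, reach `m`, continue from there with one pebble less, and take
the pebble on `m` back. If the moves are charged to squares, this doubles the charge of the first
`m` squares and keeps that of the others, so by Pascal's rule the first `∑ i ≤ k, S.choose i`
squares can be played with `S + 1` pebbles at a charge of at most `2 ^ k` each (`exists_path`). For
`γ < γ' < 1/2` and `k ≈ γ' S`, this number of squares exceeds `2 ^ (H γ * S)`, because the
largest of the `N + 1` terms in the expansion of `(k + (N - k)) ^ N` is the one with index `k`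
(`mul_binEntropy_le_log_choose`). The exponent is therefore at most `γ' + H γ`.

Lower bound: a solution on `n ≥ 2` squares contains, for some `0 < m < n`, two disjoint solutions
on `m` squares and, disjoint from these, one on `n - m` squares with one pebble less
(`Path.exists_three`). Here `m` is the highest position ever taken by the lowest pebble. The
recursion `F n S ≥ 2 F m S + F (n - m) (S - 1)` gives
`F n S ≥ 2 ^ k * (n - (S + k).choose k)` for every `k` (`Path.mul_le_time_add`). For `γ' < γ` and
`k ≈ γ' S` the binomial coefficient is at most a quarter of
`2 ^ ((1 + γ) * H (γ / (1 + γ)) * S)`, by comparison with the binomial distribution with parameter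
`γ / (1 + γ)` (`log_choose_le`). The exponent is therefore at least
`γ' + (1 + γ) * H (γ / (1 + γ)) - o(1)`.

In both cases `γ'` is arbitrarily close to `γ`. Finally, `log 2` times the difference of the two
entropy expressions is `-(1 - γ) log (1 - γ) - (1 + γ) log (1 + γ)`, where the linear terms cancel.
-/

namespace PebbleGame

/-! ### Sequences of moves -/

/-- `Path n S c c' t` says that `t` moves on `n` squares lead from the configuration `c` to `c'`,
with at most `S` pebbles on the board throughout (at both ends too). -/
inductive Path (n S : ℕ) (c : Finset ℕ) : Finset ℕ → ℕ → Prop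
  | nil (h : c.card ≤ S) : Path n S c c 0
  | snoc {c' c'' : Finset ℕ} {t : ℕ} (p : Path n S c c' t) (hm : Move n c' c'')
      (h : c''.card ≤ S) : Path n S c c'' (t + 1)

theorem Move.symm {n : ℕ} {c c' : Finset ℕ} (h : Move n c c') : Move n c' c := by
  obtain ⟨i, h1, hn, hi, ⟨hc, rfl⟩ | ⟨hc, rfl⟩⟩ := h
  · refine ⟨i, h1, hn, hi.imp_right fun h => Finset.mem_insert_of_mem h, Or.inr ⟨by simp, ?_⟩⟩
    rw [Finset.erase_insert hc]
  · refine ⟨i, h1, hn, ?_, Or.inl ⟨by simp, ?_⟩⟩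
    · exact hi.imp_right fun h => Finset.mem_erase.2 ⟨by omega, h⟩
    · rw [Finset.insert_erase hc]

theorem Path.card_right {n S : ℕ} {c c' : Finset ℕ} {t : ℕ} (p : Path n S c c' t) :
    c'.card ≤ S := by
  cases p <;> assumption

theorem Path.trans {n S : ℕ} {c c' c'' : Finset ℕ} {t t' : ℕ} (p : Path n S c c' t)
    (q : Path n S c' c'' t') : Path n S c c'' (t + t') := by
  induction q with
  | nil _ => exact p
  | snoc _ hm h ih => exact ih.snoc hm h

theorem Path.symm {n S : ℕ} {c c' : Finset ℕ} {t : ℕ} (p : Path n S c c' t) :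
    Path n S c' c t := by
  induction p with
  | nil h => exact .nil h
  | snoc p hm h ih =>
    rw [add_comm]
    exact (Path.snoc (.nil h) hm.symm p.card_right).trans ih

theorem Path.mono {n S S' : ℕ} (hS : S ≤ S') {c c' : Finset ℕ} {t : ℕ} (p : Path n S c c' t) :
    Path n S' c c' t := by
  induction p with
  | nil h => exact .nil (h.trans hS)
  | snoc _ hm h ih => exact ih.snoc hm (h.trans hS)

theorem Path.of_fun {n S : ℕ} {g : ℕ → Finset ℕ} {a b : ℕ} (hab : a ≤ b)
    (hS : ∀ s ≤ b, (g s).card ≤ S) (hg : ∀ s < b, Move n (g s) (g (s + 1))) :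
    Path n S (g a) (g b) (b - a) := by
  induction b, hab using Nat.le_induction with
  | base => rw [Nat.sub_self]; exact .nil (hS _ le_rfl)
  | succ b hab ih =>
    rw [Nat.succ_sub hab]
    exact (ih (fun s hs => hS s (by omega)) fun s hs => hg s (by omega)).snoc
      (hg b (by omega)) (hS _ le_rfl)

theorem Path.exists_fun {n S : ℕ} {c c' : Finset ℕ} {t : ℕ} (p : Path n S c c' t) :
    ∃ g : ℕ → Finset ℕ, g 0 = c ∧ g t = c' ∧ (∀ s ≤ t, (g s).card ≤ S) ∧
      ∀ s < t, Move n (g s) (g (s + 1)) := by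
  induction p with
  | nil h => exact ⟨fun _ => c, rfl, rfl, fun _ _ => h, by simp⟩
  | @snoc c' c'' t p hm h ih =>
    obtain ⟨g, h0, ht, hS, hg⟩ := ih
    refine ⟨fun s => if s ≤ t then g s else c'', by simpa using h0, by simp, fun s hs => ?_,
      fun s hs => ?_⟩
    · dsimp only
      split_ifs with hst
      exacts [hS s hst, h]
    · dsimp only
      rcases Nat.lt_succ_iff_lt_or_eq.1 hs with h' | rfl
      · rw [if_pos h'.le, if_pos (Nat.succ_le_of_lt h')]
        exact hg s h'
      · rw [if_pos le_rfl, if_neg (by omega), ht]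
        exact hm

theorem Solution.path {n S : ℕ} (s : Solution n) (hs : s.space ≤ S) :
    Path n S ∅ {n} s.time := by
  have h := Path.of_fun (n := n) (S := S) (g := s.config) (Nat.zero_le s.time)
    (fun t ht => (Finset.le_sup (f := fun t => (s.config t).card)
      (Finset.mem_range.2 (Nat.lt_succ_of_le ht))).trans hs) s.step
  rwa [s.start, s.finish] at h

theorem Path.F_le {n S t : ℕ} (p : Path n S ∅ {n} t) : F n S ≤ t := by
  obtain ⟨g, h0, ht, hS, hg⟩ := p.exists_fun
  exact (iInf_le _ (⟨t, g, h0, ht, hg⟩ : Solution n)).trans <| iInf_le _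
    (Finset.sup_le fun s hs => hS s (Nat.lt_succ_iff.1 (Finset.mem_range.1 hs)))

/-! ### A strategy that is good enough -/

/-- A play on `w` squares can be carried out on the squares `l + 1, …, l + w` of a larger board,
next to a set `D` of pebbles that stay in place, if square `l` is occupied or `l = 0`. -/
theorem Path.frame {w S : ℕ} {c c' : Finset ℕ} {t : ℕ} (p : Path w S c c' t) {n l : ℕ}
    (hl : l + w ≤ n) {D : Finset ℕ} (hlD : l = 0 ∨ l ∈ D) (hD : ∀ i ∈ D, i ≤ l ∨ l + w < i) :
    Path n (S + D.card) (D ∪ c.image (· + l)) (D ∪ c'.image (· + l)) t := by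
  have hcard : ∀ c : Finset ℕ, c.card ≤ S → (D ∪ c.image (· + l)).card ≤ S + D.card := by
    intro c hc
    have h1 := Finset.card_union_le D (c.image (· + l))
    have h2 : (c.image (· + l)).card ≤ c.card := Finset.card_image_le
    omega
  induction p with
  | nil h => exact .nil (hcard _ h)
  | @snoc c' c'' t p hm h ih =>
    refine ih.snoc ?_ (hcard _ h)
    obtain ⟨i, h1, hn, hi, hc⟩ := hm
    have hiD : i + l ∉ D := fun h => by
      have := hD _ h
      omega
    refine ⟨i + l, by omega, by omega, ?_, ?_⟩
    · rcases hi with rfl | hi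
      · rcases hlD with rfl | hlD
        · exact Or.inl rfl
        · right
          rw [Nat.add_sub_cancel_left]
          exact Finset.mem_union_left _ hlD
      · exact Or.inr (Finset.mem_union_right _ (Finset.mem_image.2 ⟨i - 1, hi, by omega⟩))
    · refine hc.imp ?_ ?_
      · rintro ⟨hic, rfl⟩
        refine ⟨by simp [hiD, hic], by simp [Finset.image_insert, Finset.union_insert]⟩
      · rintro ⟨hic, rfl⟩
        refine ⟨by simp [hic], ?_⟩
        ext j
        simp only [Finset.mem_union, Finset.mem_image, Finset.mem_erase]
        constructor
        · rintro (hj | ⟨a, ⟨ha, hac⟩, rfl⟩)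
          · exact ⟨fun h => hiD (h ▸ hj), Or.inl hj⟩
          · exact ⟨by omega, Or.inr ⟨a, hac, rfl⟩⟩
        · rintro ⟨hne, hj | ⟨a, hac, rfl⟩⟩
          · exact Or.inl hj
          · exact Or.inr ⟨a, ⟨by rintro rfl; exact hne rfl, hac⟩, rfl⟩

/-- Bennett's recursion: reach square `m`, continue from there to square `m + w` with one pebble
less, and take the pebble on square `m` back. -/
theorem Path.split {m w S t t' : ℕ} (hw : 1 ≤ w) (p : Path m S ∅ {m} t)
    (q : Path w S ∅ {w} t') : Path (m + w) (S + 1) ∅ {m + w} (2 * t + t') := by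
  have h1 := (p.frame (n := m + w) (l := 0) (D := ∅) (by omega) (by simp) (by simp)).mono
    (S' := S + 1) (by simp)
  have h2 := q.frame (n := m + w) (l := m) (D := {m}) le_rfl (by simp) (by simp)
  have h3 := p.symm.frame (n := m + w) (l := 0) (D := {m + w}) (by omega) (by simp)
    (by simp; omega)
  simp only [Finset.card_singleton, Finset.image_empty, Finset.empty_union, Finset.union_empty,
    Finset.image_singleton, add_zero] at h1 h2 h3
  rw [add_comm w m] at h2
  rw [Finset.union_comm] at h3
  have := (h1.trans h2).trans h3
  rwa [show t + t' + t = 2 * t + t' by ring] at this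

theorem sum_choose_succ (S k : ℕ) :
    ∑ i ∈ Finset.range (k + 2), (S + 1).choose i =
      ∑ i ∈ Finset.range (k + 1), S.choose i + ∑ i ∈ Finset.range (k + 2), S.choose i := by
  rw [Finset.sum_range_succ', Finset.sum_range_succ' (fun i => S.choose i) (k + 1)]
  simp only [Nat.choose_succ_succ, Finset.sum_add_distrib, Nat.choose_zero_right]
  ring

theorem exists_path_one (S : ℕ) : Path 1 (S + 1) ∅ {1} 1 :=
  .snoc (.nil (by simp)) ⟨1, le_rfl, le_rfl, Or.inl rfl, Or.inl ⟨by simp, rfl⟩⟩ (by simp)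

/-- Bennett's recursion, applied so that no square is charged more than `2 ^ k` moves. -/
theorem exists_path {S k n : ℕ} (hn : 1 ≤ n)
    (hnS : n ≤ ∑ i ∈ Finset.range (k + 1), S.choose i) :
    ∃ t ≤ 2 ^ k * n, Path n (S + 1) ∅ {n} t := by
  induction S generalizing k n with
  | zero =>
    obtain rfl : n = 1 := by
      rw [Finset.sum_range_succ'] at hnS
      simp at hnS
      omega
    exact ⟨1, Nat.succ_le_of_lt (by positivity), exists_path_one 0⟩
  | succ S ih =>
    by_cases hle : n ≤ ∑ i ∈ Finset.range (k + 1), S.choose i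
    · obtain ⟨t, ht, p⟩ := ih hn hle
      exact ⟨t, ht, p.mono (by omega)⟩
    · cases k with
      | zero =>
        simp at hnS hle
        omega
      | succ k =>
        rw [sum_choose_succ] at hnS
        set w := ∑ i ∈ Finset.range (k + 1 + 1), S.choose i with hw
        have hw1 : 1 ≤ w := by
          rw [hw, Finset.sum_range_succ']
          simp
        obtain ⟨m, rfl⟩ : ∃ m, n = m + w := ⟨n - w, by omega⟩
        obtain ⟨t, ht, p⟩ := ih (k := k) (n := m) (by omega) (by omega)
        obtain ⟨t', ht', q⟩ := ih (k := k + 1) hw1 le_rfl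
        refine ⟨2 * t + t', ?_, p.split hw1 q⟩
        calc 2 * t + t' ≤ 2 * (2 ^ k * m) + 2 ^ (k + 1) * w := by omega
          _ = 2 ^ (k + 1) * (m + w) := by ring

/-! ### Every solution contains three smaller ones -/

/-- The part of a configuration on the squares `l + 1, …, l + w`, renumbered as `1, …, w`. -/
def restr (l w : ℕ) (c : Finset ℕ) : Finset ℕ :=
  (Finset.Icc 1 w).filter fun i => i + l ∈ c

theorem mem_restr {l w : ℕ} {c : Finset ℕ} {i : ℕ} :
    i ∈ restr l w c ↔ (1 ≤ i ∧ i ≤ w) ∧ i + l ∈ c := by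
  simp [restr]

theorem card_restr_le (l w : ℕ) (c : Finset ℕ) : (restr l w c).card ≤ c.card :=
  Finset.card_le_card_of_injOn (· + l) (fun _ hi => (mem_restr.1 hi).2)
    (fun _ _ _ _ h => Nat.add_right_cancel h)

theorem card_restr_lt {l w : ℕ} {c : Finset ℕ} {j : ℕ} (hj : j ∈ c) (hjl : j ≤ l) :
    (restr l w c).card < c.card := by
  refine lt_of_le_of_lt ?_ (Finset.card_erase_lt_of_mem hj)
  refine Finset.card_le_card_of_injOn (· + l) (fun i hi => ?_)
    (fun _ _ _ _ h => Nat.add_right_cancel h)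
  have := mem_restr.1 hi
  exact Finset.mem_coe.2 (Finset.mem_erase.2 ⟨by dsimp only; omega, this.2⟩)

/-- A move is a move on the restricted board, or does not change it. -/
theorem Move.restr {n : ℕ} {c c' : Finset ℕ} (h : Move n c c') (l w : ℕ)
    (hne : restr l w c ≠ restr l w c') : Move w (restr l w c) (restr l w c') := by
  obtain ⟨i, h1, hn, hi, hc⟩ := h
  have hil : l < i ∧ i ≤ l + w := by
    by_contra hcon
    apply hne
    ext j
    simp only [mem_restr]
    refine and_congr_right fun hj => ?_
    have : j + l ≠ i := by omega
    rcases hc with ⟨-, rfl⟩ | ⟨-, rfl⟩ <;> simp [this]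
  obtain ⟨j, rfl⟩ : ∃ j, i = j + l := ⟨i - l, by omega⟩
  refine ⟨j, by omega, by omega, ?_, ?_⟩
  · by_cases hj : j = 1
    · exact Or.inl hj
    · refine hi.imp (fun h => by omega) fun h => mem_restr.2 ⟨by omega, ?_⟩
      rwa [show j - 1 + l = j + l - 1 by omega]
  · refine hc.imp ?_ ?_
    · rintro ⟨hjc, rfl⟩
      refine ⟨fun h => hjc (mem_restr.1 h).2, ?_⟩
      ext a
      simp only [mem_restr, Finset.mem_insert]
      constructor
      · rintro ⟨ha, h | h⟩
        · exact Or.inl (by omega)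
        · exact Or.inr ⟨ha, h⟩
      · rintro (rfl | ⟨ha, h⟩)
        · exact ⟨by omega, Or.inl rfl⟩
        · exact ⟨ha, Or.inr h⟩
    · rintro ⟨hjc, rfl⟩
      refine ⟨mem_restr.2 ⟨by omega, hjc⟩, ?_⟩
      ext a
      simp only [mem_restr, Finset.mem_erase]
      constructor
      · rintro ⟨ha, hne, h⟩
        exact ⟨by rintro rfl; exact hne rfl, ha, h⟩
      · rintro ⟨hne, ha, h⟩
        exact ⟨ha, by omega, h⟩

/-- A move does not change both of two disjoint parts of the board. -/
theorem Move.restr_eq_or {n : ℕ} {c c' : Finset ℕ} (h : Move n c c') (m w : ℕ) :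
    PebbleGame.restr 0 m c = PebbleGame.restr 0 m c' ∨
      PebbleGame.restr m w c = PebbleGame.restr m w c' := by
  obtain ⟨i, -, -, -, hc⟩ := h
  rcases le_or_gt i m with him | him
  · right
    ext j
    simp only [mem_restr]
    refine and_congr_right fun hj => ?_
    have : j + m ≠ i := by omega
    rcases hc with ⟨-, rfl⟩ | ⟨-, rfl⟩ <;> simp [this]
  · left
    ext j
    simp only [mem_restr]
    refine and_congr_right fun hj => ?_
    have : j ≠ i := by omega
    rcases hc with ⟨-, rfl⟩ | ⟨-, rfl⟩ <;> simp [this]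

/-- The times in `[a, b)` at which the part of the board on `l + 1, …, l + w` is changed. -/
def changes (g : ℕ → Finset ℕ) (l w a b : ℕ) : Finset ℕ :=
  (Finset.Ico a b).filter fun s => restr l w (g s) ≠ restr l w (g (s + 1))

theorem Path.of_restr {n S : ℕ} {g : ℕ → Finset ℕ} {l w a b : ℕ} (hab : a ≤ b)
    (hS : ∀ s, a ≤ s → s ≤ b → (restr l w (g s)).card ≤ S)
    (hg : ∀ s < b, Move n (g s) (g (s + 1))) :
    Path w S (restr l w (g a)) (restr l w (g b)) (changes g l w a b).card := by
  induction b, hab using Nat.le_induction with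
  | base =>
    simp only [changes, Finset.Ico_self, Finset.filter_empty, Finset.card_empty]
    exact .nil (hS a le_rfl le_rfl)
  | succ b hab ih =>
    have ih := ih (fun s h1 h2 => hS s h1 (by omega)) fun s hs => hg s (by omega)
    rw [changes, ← Finset.insert_Ico_right_eq_Ico_add_one hab, Finset.filter_insert]
    split_ifs with hne
    · rw [Finset.card_insert_of_notMem (by simp)]
      exact ih.snoc ((hg b (by omega)).restr l w hne) (hS _ (by omega) le_rfl)
    · rw [← not_not.1 hne]
      exact ih

theorem config_subset {n T : ℕ} {g : ℕ → Finset ℕ} (h0 : g 0 = ∅)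
    (hg : ∀ s < T, Move n (g s) (g (s + 1))) {s : ℕ} (hs : s ≤ T) :
    g s ⊆ Finset.Icc 1 n := by
  induction s with
  | zero => simp [h0]
  | succ s ih =>
    have ih := ih (by omega)
    obtain ⟨i, h1, hn, -, ⟨-, h⟩ | ⟨-, h⟩⟩ := hg s hs
    · rw [h, Finset.insert_subset_iff]
      exact ⟨Finset.mem_Icc.2 ⟨h1, hn⟩, ih⟩
    · rw [h]
      exact (Finset.erase_subset _ _).trans ih

theorem Move.eq_of_empty {n : ℕ} {c : Finset ℕ} (h : Move n ∅ c) : c = {1} := by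
  obtain ⟨i, -, -, hi, ⟨-, rfl⟩ | ⟨h, -⟩⟩ := h
  · obtain rfl : i = 1 := by simpa using hi
    rfl
  · simp at h

theorem Move.eq_pair {n : ℕ} {c : Finset ℕ} (h : Move n c {n}) (hc : c ≠ ∅) : c = {1, n} := by
  obtain ⟨i, h1, hn, hi, ⟨hic, h⟩ | ⟨hic, h⟩⟩ := h
  · exfalso
    obtain rfl : i = n := Finset.mem_singleton.1 (h ▸ Finset.mem_insert_self i c)
    apply hc
    rw [← Finset.erase_insert hic, ← h]
    simp
  · obtain rfl : c = insert i {n} := by rw [h, Finset.insert_erase hic]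
    rcases hi with rfl | hi
    · rfl
    · simp only [Finset.mem_insert, Finset.mem_singleton] at hi
      omega

/-- Three smaller solutions are contained in a solution on `n ≥ 2` squares. In a shortest solution
let `m` be the highest position that the lowest pebble ever takes before the end. At that moment
`m` carries the only pebble on `1, …, m`, so these squares are pebbled from nothing up to `m`
before it, and cleared again after it. At all times in between they hold a pebble, so the other
`n - m` squares are played with one pebble less. -/
theorem Path.exists_three {n S t : ℕ} (hn : 2 ≤ n) (p : Path n (S + 1) ∅ {n} t) :
    ∃ m w t₁ t₂ t₃, 1 ≤ m ∧ 1 ≤ w ∧ n = m + w ∧ t₁ + t₂ + t₃ ≤ t ∧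
      Path m (S + 1) ∅ {m} t₁ ∧ Path m (S + 1) ∅ {m} t₂ ∧ Path w S ∅ {w} t₃ := by
  classical
  have hex : ∃ t, Path n (S + 1) ∅ {n} t := ⟨t, p⟩
  obtain ⟨T, hT, hTt, hmin⟩ : ∃ T, Path n (S + 1) ∅ {n} T ∧ T ≤ t ∧
      ∀ T' < T, ¬ Path n (S + 1) ∅ {n} T' :=
    ⟨Nat.find hex, Nat.find_spec hex, Nat.find_min' hex p, fun T' => Nat.find_min hex⟩
  obtain ⟨g, h0, hend, hS, hg⟩ := hT.exists_fun
  have hT0 : T ≠ 0 := by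
    rintro rfl
    rw [h0] at hend
    exact (Finset.singleton_ne_empty n) hend.symm
  have hg1 : g 1 = {1} := by
    have := hg 0 (by omega)
    rw [h0] at this
    exact this.eq_of_empty
  have hT1 : T ≠ 1 := by
    rintro rfl
    rw [hg1, Finset.singleton_inj] at hend
    omega
  have hne : ∀ s, 1 ≤ s → s < T → g s ≠ ∅ := by
    intro s h1 h2 hs
    have := Path.of_fun h2.le hS hg
    rw [hs, hend] at this
    exact hmin _ (by omega) this
  have hnen : ∀ s < T, g s ≠ {n} := by
    intro s h2 hs
    have := Path.of_fun (n := n) (S := S + 1) (g := g) (Nat.zero_le s)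
      (fun r hr => hS r (by omega)) (fun r hr => hg r (by omega))
    rw [hs, h0] at this
    exact hmin _ (by omega) this
  have hlast : g (T - 1) = {1, n} := by
    have := hg (T - 1) (by omega)
    rw [show T - 1 + 1 = T by omega, hend] at this
    exact this.eq_pair (hne _ (by omega) (by omega))
  obtain ⟨r, hr, hrmax⟩ := Finset.exists_max_image (Finset.Icc 1 (T - 1))
    (fun s => sInf (g s : Set ℕ)) ⟨1, by simp; omega⟩
  rw [Finset.mem_Icc] at hr
  have hinf : ∀ s, 1 ≤ s → s < T → sInf (g s : Set ℕ) ∈ g s := fun s h1 h2 =>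
    Finset.mem_coe.1 (Nat.sInf_mem (Finset.coe_nonempty.2
      (Finset.nonempty_iff_ne_empty.2 (hne s h1 h2))))
  set m := sInf (g r : Set ℕ) with hm
  have hmr : m ∈ g r := hinf r hr.1 (by omega)
  have hmlow : ∀ j ∈ g r, m ≤ j := fun j hj => Nat.sInf_le (Finset.mem_coe.2 hj)
  have hsub : ∀ j ∈ g r, 1 ≤ j ∧ j ≤ n := fun j hj =>
    Finset.mem_Icc.1 (config_subset h0 hg (by omega : r ≤ T) hj)
  have hmn := hsub m hmr
  have hmltn : m < n := by
    refine lt_of_le_of_ne hmn.2 fun h => hnen r (by omega) ?_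
    rw [Finset.eq_singleton_iff_unique_mem]
    refine ⟨h ▸ hmr, fun j hj => ?_⟩
    have h1 := hmlow j hj
    have h2 := hsub j hj
    omega
  obtain ⟨w, rfl⟩ : ∃ w, n = m + w := ⟨n - m, by omega⟩
  have hempty : restr 0 m (∅ : Finset ℕ) = ∅ := by
    ext j
    simp [mem_restr]
  have hmid : restr 0 m (g r) = {m} := by
    ext j
    simp only [mem_restr, add_zero, Finset.mem_singleton]
    refine ⟨fun h => le_antisymm h.1.2 (hmlow j h.2), ?_⟩
    rintro rfl
    exact ⟨⟨hmn.1, le_rfl⟩, hmr⟩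
  have hfin : restr 0 m ({m + w} : Finset ℕ) = ∅ := by
    ext j
    simp only [mem_restr, add_zero, Finset.mem_singleton, Finset.notMem_empty, iff_false]
    omega
  have hup1 : restr m w ({1} : Finset ℕ) = ∅ := by
    ext j
    simp only [mem_restr, Finset.mem_singleton, Finset.notMem_empty, iff_false]
    omega
  have hup2 : restr m w ({1, m + w} : Finset ℕ) = {w} := by
    ext j
    simp only [mem_restr, Finset.mem_singleton, Finset.mem_insert]
    omega
  have p1 := Path.of_restr (S := S + 1) (l := 0) (w := m) (Nat.zero_le r)
    (fun s _ hs => (card_restr_le _ _ _).trans (hS s (by omega))) (fun s hs => hg s (by omega))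
  have p2 := Path.of_restr (S := S + 1) (l := 0) (w := m) (show r ≤ T by omega)
    (fun s _ hs => (card_restr_le _ _ _).trans (hS s hs)) hg
  have p3 := Path.of_restr (S := S) (l := m) (w := w) (show 1 ≤ T - 1 by omega)
    (fun s h1 hs => by
      have := card_restr_lt (w := w) (hinf s h1 (by omega))
        (hrmax s (Finset.mem_Icc.2 ⟨h1, hs⟩))
      have := hS s (by omega)
      omega) (fun s hs => hg s (by omega))
  rw [h0, hempty, hmid] at p1
  rw [hend, hfin, hmid] at p2
  rw [hg1, hlast, hup1, hup2] at p3
  refine ⟨m, w, _, _, _, hmn.1, by omega, rfl, ?_, p1, p2.symm, p3⟩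
  have hd1 : Disjoint (changes g 0 m 0 r) (changes g 0 m r T) :=
    Finset.disjoint_filter_filter (Finset.Ico_disjoint_Ico_consecutive 0 r T)
  have hd2 : Disjoint (changes g 0 m 0 r ∪ changes g 0 m r T) (changes g m w 1 (T - 1)) := by
    rw [Finset.disjoint_left]
    intro s h1 h2
    simp only [changes, Finset.mem_union, Finset.mem_filter, Finset.mem_Ico] at h1 h2
    have := (hg s (by omega)).restr_eq_or m w
    tauto
  rw [← Finset.card_union_of_disjoint hd1, ← Finset.card_union_of_disjoint hd2]
  refine le_trans ?_ hTt
  refine (Finset.card_le_card (t := Finset.range T) fun s hs => ?_).trans (by simp)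
  simp only [changes, Finset.mem_union, Finset.mem_filter, Finset.mem_Ico] at hs
  rw [Finset.mem_range]
  omega

/-! ### Lower bounds on the number of moves -/

theorem Path.not_space_zero {n t : ℕ} (p : Path n 0 ∅ {n} t) : False := by
  simpa using p.card_right

theorem Path.le_time {n S t : ℕ} (p : Path n S ∅ {n} t) : n ≤ t := by
  induction n using Nat.strong_induction_on generalizing S t with
  | _ n ih =>
    obtain _ | S := S
    · exact p.not_space_zero.elim
    by_cases hn : 2 ≤ n
    · obtain ⟨m, w, t₁, t₂, t₃, hm, hw, rfl, ht, p1, p2, p3⟩ := p.exists_three hn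
      have := ih m (by omega) p1
      have := ih w (by omega) p3
      omega
    · have ht : t ≠ 0 := by
        rintro rfl
        obtain ⟨g, h0, hend, -⟩ := p.exists_fun
        exact Finset.singleton_ne_empty n (hend.symm.trans h0)
      omega

/-- The recursive lower bound, solved: for each `k`, all but `(S + k).choose k` of the squares cost
at least `2 ^ k` moves each. -/
theorem Path.mul_le_time_add {n S t : ℕ} (k : ℕ) (hn : 1 ≤ n) (p : Path n S ∅ {n} t) :
    2 ^ k * n ≤ t + 2 ^ k * (S + k).choose k := by
  induction n using Nat.strong_induction_on generalizing S t k with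
  | _ n ih =>
    obtain _ | S := S
    · exact p.not_space_zero.elim
    obtain _ | k := k
    · have := p.le_time
      omega
    by_cases h2 : 2 ≤ n
    · obtain ⟨m, w, t₁, t₂, t₃, hm, hw, rfl, ht, p1, p2, p3⟩ := p.exists_three h2
      have h1 := ih m (by omega) k hm p1
      have h2 := ih m (by omega) k hm p2
      have h3 := ih w (by omega) (k + 1) hw p3
      have hp : (S + 1 + (k + 1)).choose (k + 1) =
          (S + 1 + k).choose k + (S + (k + 1)).choose (k + 1) := by
        rw [show S + 1 + (k + 1) = (S + 1 + k) + 1 by ring, Nat.choose_succ_succ,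
          show S + (k + 1) = S + 1 + k by ring]
      rw [hp]
      calc 2 ^ (k + 1) * (m + w) = 2 ^ k * m + 2 ^ k * m + 2 ^ (k + 1) * w := by ring
        _ ≤ (t₁ + 2 ^ k * (S + 1 + k).choose k) + (t₂ + 2 ^ k * (S + 1 + k).choose k) +
            (t₃ + 2 ^ (k + 1) * (S + (k + 1)).choose (k + 1)) := by omega
        _ = (t₁ + t₂ + t₃) + 2 ^ (k + 1) *
            ((S + 1 + k).choose k + (S + (k + 1)).choose (k + 1)) := by ring
        _ ≤ _ := by omega
    · have hc : 0 < (S + 1 + (k + 1)).choose (k + 1) := Nat.choose_pos (by omega)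
      have : 2 ^ (k + 1) * n ≤ 2 ^ (k + 1) * (S + 1 + (k + 1)).choose (k + 1) :=
        Nat.mul_le_mul_left _ (by omega)
      omega

/-! ### The exponent of a bound on the number of moves -/

theorem log2_mono {x y : ℝ≥0∞} (h : x ≤ y) : log2 x ≤ log2 y :=
  EReal.div_le_div_right_of_nonneg (EReal.coe_nonneg.2 (Real.log_nonneg (by norm_num)))
    (ENNReal.log_monotone h)

theorem log2_ofReal_two_rpow (x : ℝ) : log2 (ENNReal.ofReal (2 ^ x)) = x := by
  have h2 : Real.log 2 ≠ 0 := (Real.log_pos one_lt_two).ne'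
  rw [log2, ENNReal.log_ofReal_of_pos (by positivity), Real.log_rpow two_pos, ← EReal.coe_div,
    mul_div_cancel_right₀ _ h2]

theorem inv_mul_coe {S : ℕ} (hS : 1 ≤ S) (y : ℝ) :
    ((1 / (S : ℝ) : ℝ) : EReal) * ((S * y : ℝ) : EReal) = y := by
  have : (S : ℝ) ≠ 0 := by positivity
  rw [← EReal.coe_mul]
  congr 1
  field_simp

theorem f_le {γ y : ℝ} {S t : ℕ} (hS : 1 ≤ S)
    (p : Path ⌊(2 : ℝ) ^ (γ * (S : ℝ))⌋₊ S ∅ {⌊(2 : ℝ) ^ (γ * (S : ℝ))⌋₊} t)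
    (ht : (t : ℝ) ≤ 2 ^ (S * y)) : f γ S ≤ y := by
  rw [← inv_mul_coe hS y, ← log2_ofReal_two_rpow (S * y), f]
  refine mul_le_mul_of_nonneg_left (log2_mono ?_)
    (EReal.coe_nonneg.2 (by positivity : (0 : ℝ) ≤ 1 / S))
  refine (ENat.toENNReal_mono p.F_le).trans ?_
  rw [ENat.toENNReal_coe, ← ENNReal.ofReal_natCast]
  exact ENNReal.ofReal_le_ofReal ht

theorem le_f {γ y : ℝ} {S : ℕ} (hS : 1 ≤ S)
    (h : ∀ t, Path ⌊(2 : ℝ) ^ (γ * (S : ℝ))⌋₊ S ∅ {⌊(2 : ℝ) ^ (γ * (S : ℝ))⌋₊} t →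
      (2 : ℝ) ^ (S * y) ≤ t) : y ≤ f γ S := by
  rw [← inv_mul_coe hS y, ← log2_ofReal_two_rpow (S * y), f]
  refine mul_le_mul_of_nonneg_left (log2_mono ?_)
    (EReal.coe_nonneg.2 (by positivity : (0 : ℝ) ≤ 1 / S))
  have hF : ((⌈(2 : ℝ) ^ (S * y)⌉₊ : ℕ) : ℕ∞) ≤ F ⌊(2 : ℝ) ^ (γ * (S : ℝ))⌋₊ S :=
    le_iInf₂ fun s hs => by
      rw [Nat.cast_le, Nat.ceil_le]
      exact h _ (s.path hs)
  refine le_trans ?_ (ENat.toENNReal_mono hF)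
  rw [ENat.toENNReal_coe, ← ENNReal.ofReal_natCast]
  exact ENNReal.ofReal_le_ofReal (Nat.le_ceil _)

theorem exists_error_of_eventually_le {g : ℕ → EReal} {c : ℝ}
    (h : ∀ ε > 0, ∀ᶠ S in atTop, g S ≤ ((c + ε : ℝ) : EReal)) :
    ∃ e : ℕ → ℝ, Tendsto e atTop (𝓝 0) ∧ ∀ᶠ S in atTop, g S ≤ ((c + e S : ℝ) : EReal) := by
  have hbot : ∀ S, max (g S) c ≠ ⊥ := fun S =>
    ((EReal.bot_lt_coe c).trans_le (le_max_right _ _)).ne'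
  have htop : ∀ ε > 0, ∀ᶠ S in atTop, max (g S) c ≤ ((c + ε : ℝ) : EReal) := fun ε hε => by
    filter_upwards [h ε hε] with S hS
    exact max_le hS (EReal.coe_le_coe_iff.2 (by linarith))
  have hne : ∀ᶠ S in atTop, max (g S) c ≠ ⊤ := by
    filter_upwards [htop 1 one_pos] with S hS
    exact (hS.trans_lt (EReal.coe_lt_top _)).ne
  refine ⟨fun S => (max (g S) c).toReal - c, ?_, ?_⟩
  · rw [Metric.tendsto_nhds]
    intro ε hε
    filter_upwards [htop (ε / 2) (by positivity), hne] with S hS hS'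
    rw [Real.dist_eq, sub_zero, abs_lt]
    have h1 := EReal.toReal_le_toReal hS (hbot S) (EReal.coe_ne_top _)
    have h2 := EReal.toReal_le_toReal (le_max_right (g S) (c : EReal)) (EReal.coe_ne_bot _) hS'
    rw [EReal.toReal_coe] at h1 h2
    constructor <;> linarith
  · filter_upwards [hne] with S hS
    rw [add_sub_cancel, EReal.coe_toReal hS (hbot S)]
    exact le_max_left _ _

theorem exists_error_of_eventually_ge {g : ℕ → EReal} {c : ℝ}
    (h : ∀ ε > 0, ∀ᶠ S in atTop, ((c - ε : ℝ) : EReal) ≤ g S) :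
    ∃ e : ℕ → ℝ, Tendsto e atTop (𝓝 0) ∧ ∀ᶠ S in atTop, ((c + e S : ℝ) : EReal) ≤ g S := by
  obtain ⟨e, he, hge⟩ := exists_error_of_eventually_le (g := fun S => -g S) (c := -c)
    fun ε hε => by
      filter_upwards [h ε hε] with S hS
      rw [EReal.neg_le, ← EReal.coe_neg]
      convert hS using 2
      ring
  refine ⟨fun S => -e S, by simpa using he.neg, ?_⟩
  filter_upwards [hge] with S hS
  rw [EReal.neg_le, ← EReal.coe_neg] at hS
  convert hS using 2
  ring

/-! ### Binomial coefficients and entropy -/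

theorem H_mul_log_two (γ : ℝ) : H γ * Real.log 2 = Real.binEntropy γ := by
  have h2 : Real.log 2 ≠ 0 := (Real.log_pos one_lt_two).ne'
  simp only [H, Real.logb, Real.binEntropy, Real.log_inv]
  field_simp
  ring

theorem one_add_mul_H_mul_log_two {γ : ℝ} (hγ : 0 < γ) :
    (1 + γ) * H (γ / (1 + γ)) * Real.log 2 =
      -γ * Real.log (γ / (1 + γ)) - Real.log (1 / (1 + γ)) := by
  have h1 : 1 - γ / (1 + γ) = 1 / (1 + γ) := by
    field_simp
    ring
  rw [mul_assoc, H_mul_log_two, Real.binEntropy, h1, Real.log_inv, Real.log_inv]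
  field_simp
  ring

/-- The largest term in the binomial expansion of `(k + l) ^ (k + l)` is the one with `k ^ k`. -/
theorem pow_mul_pow_mul_choose_le {k l : ℕ} (hl : 0 < l) {i : ℕ} (hi : i ≤ k + l) :
    k ^ i * l ^ (k + l - i) * (k + l).choose i ≤ k ^ k * l ^ l * (k + l).choose k := by
  have hrec : ∀ i < k + l, k ^ (i + 1) * l ^ (k + l - (i + 1)) * (k + l).choose (i + 1) *
      ((i + 1) * l) = k ^ i * l ^ (k + l - i) * (k + l).choose i * ((k + l - i) * k) := by
    intro i hi
    have h1 := Nat.choose_succ_right_eq (k + l) i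
    rw [show k + l - i = k + l - (i + 1) + 1 by omega] at h1 ⊢
    calc _ = k ^ (i + 1) * l ^ (k + l - (i + 1) + 1) *
          ((k + l).choose (i + 1) * (i + 1)) := by ring
      _ = _ := by rw [h1]; ring
  rcases le_total i k with hik | hik
  · -- The terms increase up to the index `k`.
    induction hik using Nat.decreasingInduction with
    | self => simp
    | of_succ i hik ih =>
      refine le_trans ?_ (ih (by omega))
      refine Nat.le_of_mul_le_mul_right ?_ (show 0 < (i + 1) * l by positivity)
      rw [hrec i (by omega)]
      refine Nat.mul_le_mul_left _ ?_
      calc (i + 1) * l ≤ k * l := Nat.mul_le_mul_right _ hik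
        _ = l * k := mul_comm _ _
        _ ≤ (k + l - i) * k := Nat.mul_le_mul_right _ (by omega)
  · -- They decrease afterwards.
    induction i, hik using Nat.le_induction with
    | base => simp
    | succ i hik ih =>
      refine le_trans ?_ (ih (by omega))
      refine Nat.le_of_mul_le_mul_right ?_ (show 0 < (i + 1) * l by positivity)
      rw [hrec i (by omega)]
      refine Nat.mul_le_mul_left _ ?_
      calc (k + l - i) * k ≤ l * k := Nat.mul_le_mul_right _ (by omega)
        _ = k * l := mul_comm _ _
        _ ≤ (i + 1) * l := Nat.mul_le_mul_right _ (by omega)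

theorem add_pow_le_mul_choose {k l : ℕ} (hl : 0 < l) :
    (k + l) ^ (k + l) ≤ (k + l + 1) * (k ^ k * l ^ l * (k + l).choose k) := by
  rw [add_pow]
  calc _ ≤ ∑ i ∈ Finset.range (k + l + 1), k ^ k * l ^ l * (k + l).choose k :=
        Finset.sum_le_sum fun i hi => pow_mul_pow_mul_choose_le hl
          (Nat.lt_succ_iff.1 (Finset.mem_range.1 hi))
    _ = _ := by simp

theorem mul_binEntropy_le_log_choose {N k : ℕ} (hk : 0 < k) (hkN : k < N) :
    N * Real.binEntropy (k / N) - Real.log (N + 1) ≤ Real.log (N.choose k) := by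
  obtain ⟨l, rfl⟩ : ∃ l, N = k + l := ⟨N - k, by omega⟩
  have hl : 0 < l := by omega
  have hc : 0 < (k + l).choose k := Nat.choose_pos (by omega)
  have h : ((k + l : ℝ)) ^ (k + l) ≤ (k + l + 1) * (k ^ k * l ^ l * (k + l).choose k) := by
    exact_mod_cast add_pow_le_mul_choose hl
  have h' := Real.log_le_log (by positivity) h
  rw [Real.log_mul (by positivity) (by positivity), Real.log_mul (by positivity) (by positivity),
    Real.log_mul (by positivity) (by positivity), Real.log_pow, Real.log_pow, Real.log_pow] at h'
  have h1 : 1 - (k : ℝ) / (k + l) = l / (k + l) := by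
    field_simp
    ring
  have hB : (k + l : ℝ) * Real.binEntropy (k / (k + l)) =
      (k + l) * Real.log (k + l) - k * Real.log k - l * Real.log l := by
    rw [Real.binEntropy, h1, Real.log_inv, Real.log_inv,
      Real.log_div (by positivity) (by positivity), Real.log_div (by positivity) (by positivity)]
    field_simp
    ring
  push_cast at h' ⊢
  rw [hB]
  linarith

theorem tendsto_log_succ_div : Tendsto (fun N : ℕ => Real.log (N + 1) / N) atTop (𝓝 0) := by
  have h1 : Tendsto (fun N : ℕ => Real.log ((N + 1 : ℕ) : ℝ) / ((N + 1 : ℕ) : ℝ)) atTop (𝓝 0) :=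
    (Real.isLittleO_log_id_atTop.tendsto_div_nhds_zero.comp
      tendsto_natCast_atTop_atTop).comp (tendsto_add_atTop_nat 1)
  have h2 : Tendsto (fun N : ℕ => ((N : ℝ) + 1) / N) atTop (𝓝 1) := by
    have := (tendsto_one_div_atTop_nhds_zero_nat (𝕜 := ℝ)).const_add 1
    rw [add_zero] at this
    refine this.congr' ?_
    filter_upwards [eventually_ge_atTop 1] with N hN
    field_simp
  have := h1.mul h2
  rw [zero_mul] at this
  refine this.congr' ?_
  filter_upwards [eventually_ge_atTop 1] with N hN
  push_cast
  field_simp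

theorem eventually_two_rpow_le_choose {γ γ' : ℝ} (h0 : 0 ≤ γ) (hγ : γ < γ') (h1 : γ' < 1 / 2) :
    ∀ᶠ N : ℕ in atTop, (2 : ℝ) ^ (H γ * (N + 1 : ℕ)) ≤ N.choose ⌊γ' * N⌋₊ := by
  have hγ' : 0 < γ' := h0.trans_lt hγ
  have hB : Real.binEntropy γ < Real.binEntropy γ' :=
    Real.binEntropy_strictMonoOn ⟨h0, by linarith⟩ ⟨hγ'.le, by linarith⟩ hγ
  have hdiv : Tendsto (fun N : ℕ => (⌊γ' * N⌋₊ : ℝ) / N) atTop (𝓝 γ') :=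
    (tendsto_nat_floor_mul_div_atTop hγ'.le).comp tendsto_natCast_atTop_atTop
  have hlim : Tendsto (fun N : ℕ => Real.binEntropy (⌊γ' * N⌋₊ / N) - Real.log (N + 1) / N -
      Real.binEntropy γ * (1 + 1 / N)) atTop
      (𝓝 (Real.binEntropy γ' - 0 - Real.binEntropy γ * (1 + 0))) :=
    (((Real.binEntropy_continuous.tendsto γ').comp hdiv).sub tendsto_log_succ_div).sub
      (((tendsto_one_div_atTop_nhds_zero_nat (𝕜 := ℝ)).const_add 1).const_mul _)
  have hpos : 0 < Real.binEntropy γ' - 0 - Real.binEntropy γ * (1 + 0) := by linarith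
  filter_upwards [hlim.eventually (lt_mem_nhds hpos), eventually_ge_atTop 1,
    hdiv.eventually (lt_mem_nhds hγ'), hdiv.eventually (gt_mem_nhds (by linarith : γ' < 1))]
    with N hN hN1 hk hkN
  have hN0 : (0 : ℝ) < N := by exact_mod_cast hN1
  have hk0 : 0 < ⌊γ' * N⌋₊ := by
    rw [div_pos_iff_of_pos_right hN0] at hk
    exact_mod_cast hk
  have hkN' : ⌊γ' * N⌋₊ < N := by
    rw [div_lt_one hN0] at hkN
    exact_mod_cast hkN
  have hc : 0 < N.choose ⌊γ' * N⌋₊ := Nat.choose_pos hkN'.le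
  rw [← Real.log_le_log_iff (by positivity) (by exact_mod_cast hc), Real.log_rpow two_pos,
    mul_right_comm, H_mul_log_two]
  refine le_trans ?_ (mul_binEntropy_le_log_choose hk0 hkN')
  have := mul_pos hN0 hN
  have he : (N : ℝ) * (Real.binEntropy (⌊γ' * N⌋₊ / N) - Real.log (N + 1) / N -
      Real.binEntropy γ * (1 + 1 / N)) = N * Real.binEntropy (⌊γ' * N⌋₊ / N) - Real.log (N + 1) -
      Real.binEntropy γ * (N + 1) := by
    field_simp
  push_cast
  linarith

/-- One term of the expansion of `(p + q) ^ (S + k)` with `p + q = 1` is at most `1`. -/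
theorem log_choose_le {p q : ℝ} (hp : 0 < p) (hq : 0 < q) (hpq : p + q = 1) (S k : ℕ) :
    Real.log ((S + k).choose k) ≤ -k * Real.log p - S * Real.log q := by
  have hc : 0 < (S + k).choose k := Nat.choose_pos (by omega)
  have h : p ^ k * q ^ S * (S + k).choose k ≤ 1 := by
    calc p ^ k * q ^ S * (S + k).choose k
        = p ^ k * q ^ (S + k - k) * (S + k).choose k := by rw [Nat.add_sub_cancel]
      _ ≤ ∑ i ∈ Finset.range (S + k + 1), p ^ i * q ^ (S + k - i) * (S + k).choose i :=
          Finset.single_le_sum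
            (f := fun i => p ^ i * q ^ (S + k - i) * ((S + k).choose i : ℝ))
            (fun i _ => by positivity) (Finset.mem_range.2 (by omega))
      _ = 1 := by rw [← add_pow, hpq, one_pow]
  have h' := Real.log_le_log (by positivity) h
  rw [Real.log_one, Real.log_mul (by positivity) (by positivity),
    Real.log_mul (by positivity) (by positivity), Real.log_pow, Real.log_pow] at h'
  linarith

/-! ### The exponents -/

theorem eventually_f_le {γ : ℝ} (h0 : 0 ≤ γ) (h1 : γ < 1 / 2) {ε : ℝ} (hε : 0 < ε) :
    ∀ᶠ S : ℕ in atTop, f (H γ) S ≤ ((γ + H γ + ε : ℝ) : EReal) := by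
  obtain ⟨γ', hγ, hlt⟩ := exists_between (lt_min (lt_add_of_pos_right γ hε) h1)
  rw [lt_min_iff] at hlt
  have hH : 0 ≤ H γ := by
    have h2 := Real.log_pos one_lt_two
    rw [← mul_nonneg_iff_of_pos_right h2, H_mul_log_two]
    exact Real.binEntropy_nonneg h0 (by linarith)
  have hev := (tendsto_sub_atTop_nat 1).eventually
    (eventually_two_rpow_le_choose h0 hγ hlt.2)
  filter_upwards [hev, eventually_ge_atTop 1] with S hS hS1
  obtain ⟨N, rfl⟩ : ∃ N, S = N + 1 := ⟨S - 1, by omega⟩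
  rw [Nat.add_sub_cancel] at hS
  set k := ⌊γ' * N⌋₊ with hk
  set n := ⌊(2 : ℝ) ^ (H γ * ((N + 1 : ℕ) : ℝ))⌋₊ with hn
  have hn1 : 1 ≤ n := Nat.le_floor (by
    rw [Nat.cast_one]
    exact Real.one_le_rpow one_le_two (by positivity))
  have hnle : (n : ℝ) ≤ (2 : ℝ) ^ (H γ * ((N + 1 : ℕ) : ℝ)) := Nat.floor_le (by positivity)
  have hnc : n ≤ ∑ i ∈ Finset.range (k + 1), N.choose i := by
    have : n ≤ N.choose k := by exact_mod_cast hnle.trans hS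
    exact this.trans (Finset.single_le_sum (f := fun i => N.choose i) (fun _ _ => Nat.zero_le _)
      (Finset.self_mem_range_succ k))
  obtain ⟨t, ht, p⟩ := exists_path hn1 hnc
  refine f_le (by omega) p ?_
  have hkle : (k : ℝ) ≤ γ' * N := Nat.floor_le (by
    have := h0.trans hγ.le
    positivity)
  calc (t : ℝ) ≤ 2 ^ k * n := by exact_mod_cast ht
    _ ≤ 2 ^ (k : ℝ) * 2 ^ (H γ * ((N + 1 : ℕ) : ℝ)) := by
        rw [Real.rpow_natCast]
        gcongr
    _ = 2 ^ (k + H γ * ((N + 1 : ℕ) : ℝ)) := (Real.rpow_add two_pos _ _).symm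
    _ ≤ _ := by
        refine Real.rpow_le_rpow_of_exponent_le one_le_two ?_
        push_cast
        have : γ' * N ≤ (γ + ε) * N := by gcongr; exact hlt.1.le
        nlinarith

theorem le_f_one_add_mul {γ γ' : ℝ} (h0 : 0 ≤ γ') (hγ : γ' < γ) {S : ℕ} (hS1 : 1 ≤ S)
    (hS : (γ - γ') * S * Real.log (γ / (1 + γ)) ≤ -2 * Real.log 2) :
    ((γ' + (1 + γ) * H (γ / (1 + γ)) - 3 / S : ℝ) : EReal) ≤
      f ((1 + γ) * H (γ / (1 + γ))) S := by
  have hγ0 : 0 < γ := h0.trans_lt hγ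
  have h2 := Real.log_pos one_lt_two
  have hSR : (0 : ℝ) < S := by exact_mod_cast hS1
  set G := (1 + γ) * H (γ / (1 + γ)) with hG
  have hGlog := one_add_mul_H_mul_log_two hγ0
  rw [← hG] at hGlog
  set p := γ / (1 + γ) with hp
  set q := 1 / (1 + γ) with hq
  have hp0 : 0 < p := by positivity
  have hq0 : 0 < q := by positivity
  have hpq : p + q = 1 := by
    rw [hp, hq]
    field_simp
    ring
  have hlp : Real.log p < 0 := Real.log_neg hp0 (by linarith)
  have hlq : Real.log q < 0 := Real.log_neg hq0 (by linarith)
  have hG0 : 0 ≤ G := by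
    rw [← mul_nonneg_iff_of_pos_right h2, hGlog]
    nlinarith
  set k := ⌊γ' * S⌋₊ with hk
  have hkle : (k : ℝ) ≤ γ' * S := Nat.floor_le (by positivity)
  have hlek : γ' * S - 1 ≤ k := (Nat.sub_one_lt_floor _).le
  -- The choice of `p` makes the bound on the binomial coefficient sharp for the proportion `γ`,
  -- so for `γ' < γ` it is exponentially smaller than `2 ^ (G * S)`.
  have hC : ((S + k).choose k : ℝ) ≤ 2 ^ (G * S - 2) := by
    have hc : 0 < (S + k).choose k := Nat.choose_pos (by omega)
    rw [← Real.log_le_log_iff (by exact_mod_cast hc) (by positivity), Real.log_rpow two_pos]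
    refine (log_choose_le hp0 hq0 hpq S k).trans ?_
    have h3 : (G * S - 2) * Real.log 2 =
        S * (-γ * Real.log p - Real.log q) - 2 * Real.log 2 := by
      rw [← hGlog]
      ring
    have h4 : γ' * S * Real.log p ≤ k * Real.log p := mul_le_mul_of_nonpos_right hkle hlp.le
    rw [h3]
    linarith
  refine le_f hS1 fun t pt => ?_
  set n := ⌊(2 : ℝ) ^ (G * (S : ℝ))⌋₊ with hn
  have hx1 : (1 : ℝ) ≤ 2 ^ (G * (S : ℝ)) := Real.one_le_rpow one_le_two (by positivity)
  have hn1 : 1 ≤ n := Nat.le_floor (by rwa [Nat.cast_one])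
  have hn2 : (2 : ℝ) ^ (G * (S : ℝ)) / 2 ≤ n := by
    have h3 := Nat.lt_floor_add_one ((2 : ℝ) ^ (G * (S : ℝ)))
    have h4 : (1 : ℝ) ≤ n := by exact_mod_cast hn1
    rw [← hn] at h3
    linarith
  have ht : (2 : ℝ) ^ k * n ≤ t + 2 ^ k * (S + k).choose k := by
    exact_mod_cast pt.mul_le_time_add k hn1
  have hC' : (2 : ℝ) ^ (G * S - 2) = 2 ^ (G * (S : ℝ)) / 4 := by
    rw [Real.rpow_sub two_pos]
    norm_num
  rw [hC'] at hC
  have hmul : (2 : ℝ) ^ k * (2 ^ (G * (S : ℝ)) / 4) ≤ t := by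
    have := mul_le_mul_of_nonneg_left
      (show (2 : ℝ) ^ (G * (S : ℝ)) / 4 ≤ n - (S + k).choose k by linarith)
      (show (0 : ℝ) ≤ 2 ^ k by positivity)
    linarith
  refine le_trans ?_ hmul
  rw [← hC', ← Real.rpow_natCast, ← Real.rpow_add two_pos]
  refine Real.rpow_le_rpow_of_exponent_le one_le_two ?_
  have : (S : ℝ) * (γ' + G - 3 / S) = γ' * S + G * S - 3 := by
    field_simp
  linarith

theorem eventually_le_f {γ : ℝ} (h0 : 0 ≤ γ) {ε : ℝ} (hε : 0 < ε) :
    ∀ᶠ S : ℕ in atTop, ((γ + (1 + γ) * H (γ / (1 + γ)) - ε : ℝ) : EReal) ≤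
      f ((1 + γ) * H (γ / (1 + γ))) S := by
  rcases h0.eq_or_lt with rfl | hγ
  · filter_upwards [eventually_ge_atTop 1] with S hS
    have hH : H 0 = 0 := by simp [H]
    refine le_f hS fun t p => ?_
    have hSR : (0 : ℝ) < S := by exact_mod_cast hS
    have hle := p.le_time
    simp only [zero_div, add_zero, one_mul, hH, zero_mul, Real.rpow_zero, Nat.floor_one] at hle
    have ht : (1 : ℝ) ≤ t := by exact_mod_cast hle
    refine (Real.rpow_le_one_of_one_le_of_nonpos one_le_two ?_).trans ht
    simp only [zero_div, hH]
    nlinarith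
  · obtain ⟨γ', hlt, hγ'⟩ := exists_between (max_lt hγ (by linarith : γ - ε / 2 < γ))
    rw [max_lt_iff] at hlt
    have hlog : Real.log (γ / (1 + γ)) < 0 :=
      Real.log_neg (by positivity) ((div_lt_one (by positivity)).2 (by linarith))
    have hlim : Tendsto (fun S : ℕ => (γ - γ') * Real.log (γ / (1 + γ)) * (S : ℝ)) atTop atBot :=
      tendsto_natCast_atTop_atTop.const_mul_atTop_of_neg (mul_neg_of_pos_of_neg (by linarith) hlog)
    have hlim3 := tendsto_const_div_atTop_nhds_zero_nat (3 : ℝ)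
    filter_upwards [hlim.eventually_le_atBot (-2 * Real.log 2), eventually_ge_atTop 1,
      hlim3.eventually (gt_mem_nhds (half_pos hε))] with S hS hS1 h3
    refine le_trans ?_ (le_f_one_add_mul hlt.1.le hγ' hS1 (by linarith))
    rw [EReal.coe_le_coe_iff]
    linarith [hlt.2]

/-! ### The two exponents agree to first order -/

theorem H_sub_isBigO :
    (fun γ : ℝ => H γ - (1 + γ) * H (γ / (1 + γ))) =O[𝓝[≥] (0 : ℝ)] fun γ : ℝ => γ ^ 2 := by
  have h2 := Real.log_pos one_lt_two
  refine IsBigO.of_bound (2 / Real.log 2) ?_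
  filter_upwards [Ico_mem_nhdsGE (one_pos : (0 : ℝ) < 1)] with γ hγ
  obtain ⟨h0, h1⟩ := hγ
  rcases h0.eq_or_lt with rfl | h0
  · simp [H]
  have hd : (H γ - (1 + γ) * H (γ / (1 + γ))) * Real.log 2 =
      -((1 - γ) * Real.log (1 - γ)) - (1 + γ) * Real.log (1 + γ) := by
    rw [sub_mul, one_add_mul_H_mul_log_two h0, H_mul_log_two, Real.binEntropy, Real.log_inv,
      Real.log_inv, Real.log_div h0.ne' (by positivity), one_div, Real.log_inv]
    ring
  -- Both logarithmic terms are `γ + O(γ ^ 2)`, by `1 - x⁻¹ ≤ log x ≤ x - 1`.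
  have h1' : 0 < 1 - γ := by linarith
  have hp : 0 < 1 + γ := by linarith
  have a1 := mul_le_mul_of_nonneg_left (Real.log_le_sub_one_of_pos h1') h1'.le
  have a2 := mul_le_mul_of_nonneg_left (Real.log_le_sub_one_of_pos hp) hp.le
  have a3 := mul_le_mul_of_nonneg_left (Real.one_sub_inv_le_log_of_pos h1') h1'.le
  have a4 := mul_le_mul_of_nonneg_left (Real.one_sub_inv_le_log_of_pos hp) hp.le
  rw [mul_sub, mul_inv_cancel₀ h1'.ne'] at a3
  rw [mul_sub, mul_inv_cancel₀ hp.ne'] at a4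
  rw [Real.norm_eq_abs, Real.norm_of_nonneg (by positivity), div_mul_eq_mul_div,
    le_div_iff₀ h2, ← abs_of_pos h2, ← abs_mul, hd, abs_le]
  constructor <;> nlinarith

end PebbleGame

theorem theorem2p11 :
    (∀ γ : ℝ, 0 ≤ γ → γ < 1 / 2 →
      ∃ e : ℕ → ℝ, Tendsto e atTop (𝓝 0) ∧
        ∀ᶠ S : ℕ in atTop,
          PebbleGame.f (PebbleGame.H γ) S ≤ ((γ + PebbleGame.H γ + e S : ℝ) : EReal)) ∧
    (∀ γ : ℝ, 0 ≤ γ → γ ≤ 1 / 2 →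
      ∃ e : ℕ → ℝ, Tendsto e atTop (𝓝 0) ∧
        ∀ᶠ S : ℕ in atTop,
          ((γ + (1 + γ) * PebbleGame.H (γ / (1 + γ)) + e S : ℝ) : EReal) ≤
            PebbleGame.f ((1 + γ) * PebbleGame.H (γ / (1 + γ))) S) ∧
    ((fun γ : ℝ => PebbleGame.H γ - (1 + γ) * PebbleGame.H (γ / (1 + γ)))
      =O[𝓝[≥] (0 : ℝ)] fun γ : ℝ => γ ^ 2) ∧
    ((fun γ : ℝ => (γ + PebbleGame.H γ) - (γ + (1 + γ) * PebbleGame.H (γ / (1 + γ))))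
      =O[𝓝[≥] (0 : ℝ)] fun γ : ℝ => γ ^ 2) := by
  refine ⟨fun γ h0 h1 => ?_, fun γ h0 _ => ?_, PebbleGame.H_sub_isBigO, ?_⟩
  · exact PebbleGame.exists_error_of_eventually_le fun ε hε =>
      PebbleGame.eventually_f_le h0 h1 hε
  · exact PebbleGame.exists_error_of_eventually_ge fun ε hε => PebbleGame.eventually_le_f h0 hε
  · simpa only [add_sub_add_left_eq_sub] using PebbleGame.H_sub_isBigO
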